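/- Let $h_1,\dots,h_m\in\mathbb R[x]=\mathbb R[x_1,\dots,x_n]$, $I=\langle h_1,\dots,h_m\rangle$, $d_j=\lceil \deg(h_j)/2\rceil$ and $d=\max_j d_j$. For an ideal $L\subseteq\mathbb R[x]$ let $V_{\mathbb C}(L)\subseteq\mathbb C^n$ be its set of complex zeros and $V_{\mathbb R}(L)=V_{\mathbb C}(L)\cap\mathbb R^n$; for $V\subseteq\mathbb C^n$ let $I(V)=\{f\in\mathbb R[x] : f(v)=0\ \forall v\in V\}$. Let $\mathbb N^n_k=\{\alpha\in\mathbb N^n : |\alpha|\le k\}$. For a real sequence $y=(y_\alpha)$, put $M_s(y)=(y_{\alpha+\beta})_{\alpha,\beta\in\mathbb N^n_s}$ and, for $h=\sum_\beta h_\beta x^\beta$, $(hy)_\alpha=\sum_\beta h_\beta y_{\alpha+\beta}$. Let $\operatorname{Ker}M_s(y)$ be the set of polynomials of degree at most $s$ whose vector of coefficients $(f_\alpha)_{\alpha\in\mathbb N^n_s}$ is in the kernel of $M_s(y)$. For $t\ge d$ let $$K_t^{\mathbb R}=\{y\in\mathbb R^{\mathbb N^n_{2t}} : y_0=1,\ M_t(y)\succeq0,\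 M_{t-d_j}(h_jy)=0\ (j=1,\dots,m)\}.$$ Let $t\ge d$, let $y\in K_t^{\mathbb R}$ be such that $\operatorname{rank}M_t(y)$ is maximum over $K_t^{\mathbb R}$, and suppose that for some $1\le s\le t$ $$\operatorname{rank}M_s(y)=\operatorname{rank}M_{s-1}(y)=:r .$$ Let $J=\langle\operatorname{Ker}M_s(y)\rangle$ and $W=V_{\mathbb C}(J)$. Then: 1. $J\subseteq I(V_{\mathbb R}(I))$. 2. $W$ can be computed from $M_s(y)$ by linear algebra, in the following sense. There is a set $\mathcal B\subseteq\mathbb N^n_{s-1}$ that indexes a nonsingular principal submatrix $M_{\mathcal B}$ of $M_{s-1}(y)$ of maximum size. For every such $\mathcal B$, let $P_i=(y_{\beta+e_i+\gamma})_{\beta,\gamma\in\mathcal B}$ and $\mathcal X_i=M_{\mathcal B}^{-1}P_i$ $(i=1,\dots,n)$. Then $W$ is the set of joint eigenvalues of $\mathcal X_1^T,\dots,\mathcal X_n^T$, that is, $$W=\{v\in\mathbb C^n : \exists\, u\in\mathbb C^{\mathcal B}\setminus\{0\},\ \mathcal X_i^Tu=v_iu\ (i=1,\dots,n)\}.$$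 3. $V_{\mathbb R}(I)\subseteq W$ and $|W|=r$. 4. If $V_{\mathbb R}(I)=W$, then $I(V_{\mathbb R}(I))=J$. -/

import Mathlib

namespace RealMoment

noncomputable section

/-- The exponents `α ∈ ℕⁿ` with `|α| = ∑ i, α i ≤ k`; equivalently the monomials of degree at
most `k` in `n` variables. -/
abbrev MonoIdx (n k : ℕ) : Type := {α : Fin n →₀ ℕ // α.degree ≤ k}

instance instFintypeMonoIdx (n k : ℕ) : Fintype (MonoIdx n k) :=
  (Finsupp.finite_of_degree_le k).fintype

/-- A truncated sequence `(y_α)_{|α| ≤ k}`, extended by zero to all exponents. In the definitions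
below it is evaluated only at exponents of degree at most `k`. -/
def extend {n k : ℕ} (y : MonoIdx n k → ℝ) (α : Fin n →₀ ℕ) : ℝ :=
  if hα : α.degree ≤ k then y ⟨α, hα⟩ else 0

/-- The truncated real moment matrix `M_s(y) = (y_{α+β})`, `|α|, |β| ≤ s`. -/
def momentMatrix {n : ℕ} (y : (Fin n →₀ ℕ) → ℝ) (s : ℕ) :
    Matrix (MonoIdx n s) (MonoIdx n s) ℝ :=
  Matrix.of fun α β => y (α.1 + β.1)

/-- The sequence `hy`, with `(hy)_α = ∑_β h_β y_{α+β}`. -/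
def shift {n : ℕ} (h : MvPolynomial (Fin n) ℝ) (y : (Fin n →₀ ℕ) → ℝ) (α : Fin n →₀ ℕ) : ℝ :=
  ∑ β ∈ h.support, h.coeff β * y (α + β)

/-- `⌈deg h / 2⌉`. -/
def halfDeg {n : ℕ} (h : MvPolynomial (Fin n) ℝ) : ℕ := ⌈(h.totalDegree : ℚ) / 2⌉₊

/-- `d = max_j ⌈deg h_j / 2⌉`. -/
def maxHalfDeg {n m : ℕ} (h : Fin m → MvPolynomial (Fin n) ℝ) : ℕ :=
  Finset.univ.sup fun j => halfDeg (h j)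

/-- The set `K_t` of the sequences `(y_α)_{|α| ≤ 2t}` with `y_0 = 1`, `M_t(y) ⪰ 0` and
`M_{t - d_j}(h_j y) = 0` for all `j`, where `d_j = ⌈deg h_j / 2⌉` (used for `t ≥ max_j d_j`). -/
def feasible {n m : ℕ} (h : Fin m → MvPolynomial (Fin n) ℝ) (t : ℕ) :
    Set (MonoIdx n (2 * t) → ℝ) :=
  {y | extend y 0 = 1 ∧ (momentMatrix (extend y) t).PosSemidef ∧
    ∀ j, momentMatrix (shift (h j) (extend y)) (t - halfDeg (h j)) = 0}

/-- `Ker M_s(y)` as a set of polynomials: those of degree at most `s` whose vector of coefficients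
lies in the kernel of the matrix. -/
def momentKer {n : ℕ} (y : (Fin n →₀ ℕ) → ℝ) (s : ℕ) : Set (MvPolynomial (Fin n) ℝ) :=
  {f | f.totalDegree ≤ s ∧
    (momentMatrix y s).mulVec (fun α : MonoIdx n s => f.coeff α.1) = 0}

/-- `V_ℂ(I) ⊆ ℂⁿ`. -/
def complexVariety {n : ℕ} (I : Ideal (MvPolynomial (Fin n) ℝ)) : Set (Fin n → ℂ) :=
  MvPolynomial.zeroLocus ℂ I

/-- `V_ℝ(I) = V_ℂ(I) ∩ ℝⁿ`, as a subset of `ℂⁿ`. -/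
def realVariety {n : ℕ} (I : Ideal (MvPolynomial (Fin n) ℝ)) : Set (Fin n → ℂ) :=
  complexVariety I ∩ {v | ∃ x : Fin n → ℝ, v = fun i => (x i : ℂ)}

/-- The principal submatrix of `M_k(y)` indexed by a set `B` of monomials. -/
def principal {n k : ℕ} (y : (Fin n →₀ ℕ) → ℝ) (B : Finset (MonoIdx n k)) : Matrix B B ℝ :=
  (momentMatrix y k).submatrix (fun b => b.1) (fun b => b.1)

/-- `B` indexes a maximum nonsingular principal submatrix of `M_k(y)`. -/
def IsMaxNonsingular {n k : ℕ} (y : (Fin n →₀ ℕ) → ℝ) (B : Finset (MonoIdx n k)) : Prop :=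
  (principal y B).det ≠ 0 ∧
    ∀ B' : Finset (MonoIdx n k), (principal y B').det ≠ 0 → B'.card ≤ B.card

/-- The submatrix of `M_{k+1}(y)` with rows indexed by `B` and columns indexed by `x_i B`. -/
def shiftedBlock {n k : ℕ} (y : (Fin n →₀ ℕ) → ℝ) (B : Finset (MonoIdx n k)) (i : Fin n) :
    Matrix B B ℝ :=
  Matrix.of fun b c => y (b.1.1 + (Finsupp.single i 1 + c.1.1))

/-- The formal multiplication matrix `𝒳_i = M_B⁻¹ P_i` computed from the entries of
`M_{k+1}(y)`. -/
def formalMul {n k : ℕ} (y : (Fin n →₀ ℕ) → ℝ) (B : Finset (MonoIdx n k)) (i : Fin n) :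
    Matrix B B ℝ :=
  (principal y B)⁻¹ * shiftedBlock y B i

/-- The set of `v ∈ ℂⁿ` such that the matrices `𝒳_1ᵀ, …, 𝒳_nᵀ` have a common (complex) eigenvector
with `v_i` as the eigenvalue of `𝒳_iᵀ`. -/
def jointEigenvalues {n : ℕ} {ι : Type*} [Fintype ι] (X : Fin n → Matrix ι ι ℝ) :
    Set (Fin n → ℂ) :=
  {v | ∃ u : ι → ℂ, u ≠ 0 ∧
    ∀ i, ((X i).transpose.map (fun a : ℝ => (a : ℂ))).mulVec u = v i • u}

end

end RealMoment

namespace RealMoment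

noncomputable section

open MvPolynomial Matrix

variable {n : ℕ}

/-! Put k = s - 1. Flatness makes the columns of a maximal nonsingular block B of M_k(y) span those
of M_{k+1}(y), so polynomials of degree at most k + 1 reduce to the span of B modulo the kernel.
Multiplying by x_i and reducing gives the matrices `formalMul`; they commute (`formalMul_comm`),
hence define an algebra map, and J is the annihilator of the coordinate vector of 1
(`IsFlat.mem_span_iff`). Thus B is a basis of ℝ[x]/J.

These matrices are self-adjoint for the inner product M_B, whose positivity shows that p² + q² ∈ J
forces p ∈ J (`mem_span_of_sq_add_sq_mem`). Hence J is radical with only real zeros, J = I(W) and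
|W| = |B| = r. Joint eigenvectors of the transposes are, up to scaling, evaluations at points of W.

Maximal rank gives J ⊆ I(V_ℝ(I)): the average of y with a point mass at a real zero is feasible, and
the kernel of its moment matrix is the intersection of the two kernels, so Ker M_t(y) lies in the
kernel for the point mass (`momentKer_subset_vanishingIdeal`). Positivity gives Ker M_s(y) ⊆ Ker
M_t(y) (`momentKer_mono`). -/

/-! ### The Riesz functional and kernels of moment matrices. -/

/-- The Riesz functional `x^α ↦ y_α`. -/
def riesz (y : (Fin n →₀ ℕ) → ℝ) : MvPolynomial (Fin n) ℝ →ₗ[ℝ] ℝ :=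
  (basisMonomials (Fin n) ℝ).constr ℝ y

@[simp]
theorem riesz_monomial (y : (Fin n →₀ ℕ) → ℝ) (α : Fin n →₀ ℕ) (a : ℝ) :
    riesz y (monomial α a) = a * y α := by
  have h : riesz y (monomial α 1) = y α := by
    exact (basisMonomials (Fin n) ℝ).constr_basis ℝ y α
  rw [← mul_one a, ← smul_eq_mul, ← smul_monomial, map_smul, h, smul_eq_mul, smul_eq_mul, mul_one]

/-- A linear map killing all monomials of degree at most `k` kills all polynomials of degree
at most `k`. -/
theorem map_eq_zero_of_totalDegree_le {E : Type*} [AddCommGroup E] [Module ℝ E]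
    (F : MvPolynomial (Fin n) ℝ →ₗ[ℝ] E) {k : ℕ}
    (hF : ∀ α : Fin n →₀ ℕ, α.degree ≤ k → F (monomial α 1) = 0)
    {p : MvPolynomial (Fin n) ℝ} (hp : p.totalDegree ≤ k) : F p = 0 := by
  rw [p.as_sum, map_sum]
  refine Finset.sum_eq_zero fun α hα => ?_
  rw [← mul_one (p.coeff α), ← smul_eq_mul, ← smul_monomial, map_smul, hF, smul_zero]
  exact (le_totalDegree hα).trans hp

theorem totalDegree_monomial_one (α : Fin n →₀ ℕ) :
    (monomial α (1 : ℝ)).totalDegree = α.degree :=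
  totalDegree_monomial α one_ne_zero

/-- The polynomial of degree at most `k` with given coefficients. -/
theorem sum_coeff_monomial {k : ℕ} {p : MvPolynomial (Fin n) ℝ} (hp : p.totalDegree ≤ k) :
    ∑ β : MonoIdx n k, monomial β.1 (p.coeff β.1) = p := by
  ext α
  rw [coeff_sum]
  simp only [coeff_monomial]
  by_cases hα : α.degree ≤ k
  · rw [Finset.sum_eq_single (⟨α, hα⟩ : MonoIdx n k)]
    · simp
    · intro b _ hb
      rw [if_neg]
      rintro rfl
      exact hb rfl
    · simp
  · rw [coeff_eq_zero_of_totalDegree_lt (lt_of_le_of_lt hp (not_le.1 hα)), Finset.sum_eq_zero]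
    intro b _
    rw [if_neg]
    rintro rfl
    exact hα b.2

theorem momentMatrix_mulVec_coeff (y : (Fin n →₀ ℕ) → ℝ) {s : ℕ} {p : MvPolynomial (Fin n) ℝ}
    (hp : p.totalDegree ≤ s) (α : MonoIdx n s) :
    (momentMatrix y s *ᵥ fun β => p.coeff β.1) α = riesz y (monomial α.1 1 * p) := by
  conv_rhs => rw [← sum_coeff_monomial hp]
  simp only [Finset.mul_sum, map_sum, monomial_mul, one_mul, riesz_monomial]
  simp [mulVec, dotProduct, momentMatrix, mul_comm]

theorem mem_momentKer_iff_monomial {y : (Fin n →₀ ℕ) → ℝ} {s : ℕ} {p : MvPolynomial (Fin n) ℝ} :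
    p ∈ momentKer y s ↔ p.totalDegree ≤ s ∧
      ∀ α : Fin n →₀ ℕ, α.degree ≤ s → riesz y (monomial α 1 * p) = 0 := by
  refine and_congr_right fun hp => ⟨fun h α hα => ?_, fun h => funext fun α => ?_⟩
  · rw [← momentMatrix_mulVec_coeff y hp ⟨α, hα⟩, h, Pi.zero_apply]
  · exact (momentMatrix_mulVec_coeff y hp α).trans (h α.1 α.2)

theorem riesz_mul_eq_zero {y : (Fin n →₀ ℕ) → ℝ} {s : ℕ} {p q : MvPolynomial (Fin n) ℝ}
    (hp : p ∈ momentKer y s) (hq : q.totalDegree ≤ s) : riesz y (q * p) = 0 :=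
  map_eq_zero_of_totalDegree_le ((riesz y).comp (LinearMap.mulRight ℝ p))
    (fun α hα => (mem_momentKer_iff_monomial.1 hp).2 α hα) hq

theorem dotProduct_momentMatrix_coeff (y : (Fin n →₀ ℕ) → ℝ) {s : ℕ}
    {p q : MvPolynomial (Fin n) ℝ} (hp : p.totalDegree ≤ s) (hq : q.totalDegree ≤ s) :
    (fun α : MonoIdx n s => p.coeff α.1) ⬝ᵥ momentMatrix y s *ᵥ (fun α => q.coeff α.1) =
      riesz y (p * q) := by
  conv_rhs => rw [← sum_coeff_monomial hp]
  rw [Finset.sum_mul, map_sum, dotProduct]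
  refine Finset.sum_congr rfl fun α _ => ?_
  rw [momentMatrix_mulVec_coeff y hq, ← smul_eq_mul (p.coeff _), ← map_smul, ← smul_mul_assoc,
    smul_monomial, smul_eq_mul, mul_one]

/-- For a positive semidefinite M, Mu = 0 as soon as uᵀMu = 0. Here the quadratic form is L(p²),
which the smaller kernel already makes zero. -/
theorem momentKer_mono {y : (Fin n →₀ ℕ) → ℝ} {s t : ℕ} (hst : s ≤ t)
    (hpsd : (momentMatrix y t).PosSemidef) : momentKer y s ⊆ momentKer y t := by
  intro p hp
  refine ⟨hp.1.trans hst, ?_⟩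
  rw [← hpsd.dotProduct_mulVec_zero_iff, star_trivial,
    dotProduct_momentMatrix_coeff y (hp.1.trans hst) (hp.1.trans hst)]
  exact riesz_mul_eq_zero hp hp.1

theorem momentMatrix_posSemidef_mono {y : (Fin n →₀ ℕ) → ℝ} {s t : ℕ} (hst : s ≤ t)
    (hpsd : (momentMatrix y t).PosSemidef) : (momentMatrix y s).PosSemidef :=
  hpsd.submatrix fun α : MonoIdx n s => (⟨α.1, α.2.trans hst⟩ : MonoIdx n t)

/-! ### Maximal nonsingular principal submatrices. -/

/-- A positive semidefinite matrix has a nonsingular principal submatrix of size its rank. -/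
theorem exists_principal_det_ne_zero {ι : Type*} [Fintype ι] [DecidableEq ι] {M : Matrix ι ι ℝ}
    (hM : M.PosSemidef) :
    ∃ B : Finset ι, (M.submatrix (fun b : B => b.1) (fun b : B => b.1)).det ≠ 0 ∧
      B.card = M.rank := by
  classical
  obtain ⟨κ, a, ha, hsp, hli⟩ := exists_linearIndependent' ℝ M.col
  have : Fintype κ := Fintype.ofInjective a ha
  obtain ⟨B, hB⟩ : ∃ B, B = Finset.univ.image a := ⟨_, rfl⟩
  refine ⟨B, fun hdet => ?_, ?_⟩
  · obtain ⟨v, hv, hv0⟩ := exists_mulVec_eq_zero_iff.2 hdet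
    -- Extending a kernel vector v of the block by zero gives wᵀMw = 0, hence Mw = 0 by positivity,
    -- a relation among independent columns.
    let w : ι → ℝ := fun i => if h : i ∈ B then v ⟨i, h⟩ else 0
    have hw : ∀ b : B, w b.1 = v b := fun b => by simp [w]
    have hsum : ∀ f : ι → ℝ, ∑ i, f i * w i = ∑ b : B, f b.1 * v b := by
      intro f
      simp only [← hw]
      rw [Finset.sum_coe_sort B (fun i => f i * w i)]
      refine (Finset.sum_subset (Finset.subset_univ B) fun i _ hi => ?_).symm
      simp [w, hi]
    have hMw : M *ᵥ w = 0 := by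
      rw [← hM.dotProduct_mulVec_zero_iff, star_trivial, dotProduct_comm, dotProduct, hsum]
      refine Finset.sum_eq_zero fun b _ => ?_
      have := congrFun hv0 b
      simp only [mulVec, dotProduct, hsum, submatrix_apply, Pi.zero_apply] at this ⊢
      rw [this, zero_mul]
    have hinj := Fintype.linearIndependent_iff.1 hli (fun j => w (a j)) ?_
    · apply hv
      funext b
      obtain ⟨j, -, hj⟩ := Finset.mem_image.1 (by rw [← hB]; exact b.2)
      rw [← hw b, ← hj, hinj j, Pi.zero_apply]
    · funext i
      have h1 := congrFun hMw i
      simp only [mulVec, dotProduct, hsum, Pi.zero_apply] at h1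
      simp only [← hw] at h1
      rw [Finset.sum_coe_sort B (fun j => M i j * w j),
        hB, Finset.sum_image (fun x _ z _ h => ha h)] at h1
      simpa [mul_comm] using h1
  · rw [hB, Finset.card_image_of_injective _ ha, Finset.card_univ, rank_eq_finrank_span_cols, ← hsp,
      finrank_span_eq_card hli]

theorem principal_card_le_rank {n k : ℕ} {y : (Fin n →₀ ℕ) → ℝ} {B : Finset (MonoIdx n k)}
    (hB : (principal y B).det ≠ 0) : B.card ≤ (momentMatrix y k).rank := by
  rw [← Fintype.card_coe, ← rank_of_det_ne_zero hB]
  exact rank_submatrix_le _ _ _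

theorem exists_isMaxNonsingular {k : ℕ} {y : (Fin n →₀ ℕ) → ℝ}
    (hM : (momentMatrix y k).PosSemidef) :
    ∃ B : Finset (MonoIdx n k), IsMaxNonsingular y B := by
  obtain ⟨B, hB, hc⟩ := exists_principal_det_ne_zero hM
  exact ⟨B, hB, fun B' hB' => hc ▸ principal_card_le_rank hB'⟩

theorem IsMaxNonsingular.card_eq_rank {k : ℕ} {y : (Fin n →₀ ℕ) → ℝ} {B : Finset (MonoIdx n k)}
    (hB : IsMaxNonsingular y B) (hM : (momentMatrix y k).PosSemidef) :
    B.card = (momentMatrix y k).rank := by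
  obtain ⟨B', hB', hc⟩ := exists_principal_det_ne_zero hM
  exact le_antisymm (principal_card_le_rank hB.1) (hc ▸ hB.2 B' hB')

/-! ### Reduction to the span of B and the formal multiplication matrices. -/

/-- `B` indexes a maximum nonsingular principal submatrix of the positive semidefinite moment
matrix `M_{k+1}(y)`, and all its elements have degree at most `k`. -/
structure IsFlat {n k : ℕ} (y : (Fin n →₀ ℕ) → ℝ) (B : Finset (MonoIdx n k)) : Prop where
  posSemidef : (momentMatrix y (k + 1)).PosSemidef
  det_ne_zero : (principal y B).det ≠ 0
  card_eq : B.card = (momentMatrix y (k + 1)).rank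

/-- The polynomial `∑_{b ∈ B} d_b x^b`. -/
def ofCoords {k : ℕ} (B : Finset (MonoIdx n k)) : (B → ℝ) →ₗ[ℝ] MvPolynomial (Fin n) ℝ :=
  Fintype.linearCombination ℝ fun b : B => monomial b.1.1 (1 : ℝ)

/-- The vector `M_B⁻¹ (L(x^b p))_{b ∈ B}`. -/
def coords {k : ℕ} (y : (Fin n →₀ ℕ) → ℝ) (B : Finset (MonoIdx n k)) :
    MvPolynomial (Fin n) ℝ →ₗ[ℝ] (B → ℝ) :=
  (principal y B)⁻¹.mulVecLin ∘ₗ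
    LinearMap.pi fun b : B => (riesz y).comp (LinearMap.mulLeft ℝ (monomial b.1.1 (1 : ℝ)))

variable {k : ℕ} {y : (Fin n →₀ ℕ) → ℝ} {B : Finset (MonoIdx n k)}

theorem ofCoords_apply (d : B → ℝ) : ofCoords B d = ∑ b : B, monomial b.1.1 (d b) := by
  simp [ofCoords, Fintype.linearCombination_apply, smul_monomial]

theorem ofCoords_single (b : B) : ofCoords B (Pi.single b 1) = monomial b.1.1 1 := by
  simp [ofCoords, Fintype.linearCombination_apply_single]

theorem totalDegree_ofCoords_le (d : B → ℝ) : (ofCoords B d).totalDegree ≤ k := by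
  rw [ofCoords_apply]
  refine totalDegree_finsetSum_le fun b _ => (totalDegree_monomial_le _ _).trans b.1.2

theorem coords_apply (p : MvPolynomial (Fin n) ℝ) :
    coords y B p = (principal y B)⁻¹ *ᵥ fun b : B => riesz y (monomial b.1.1 1 * p) :=
  rfl

theorem riesz_mul_ofCoords (d : B → ℝ) (q : MvPolynomial (Fin n) ℝ) :
    riesz y (q * ofCoords B d) = ∑ b : B, riesz y (q * monomial b.1.1 1) * d b := by
  simp only [ofCoords, Fintype.linearCombination_apply, Finset.mul_sum, map_sum, mul_smul_comm,
    map_smul, smul_eq_mul]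
  exact Finset.sum_congr rfl fun b _ => mul_comm _ _

theorem principal_mulVec (d : B → ℝ) :
    principal y B *ᵥ d = fun b : B => riesz y (monomial b.1.1 1 * ofCoords B d) := by
  funext b
  rw [riesz_mul_ofCoords]
  simp [principal, momentMatrix, mulVec, dotProduct, monomial_mul]

theorem shiftedBlock_mulVec (i : Fin n) (d : B → ℝ) :
    shiftedBlock y B i *ᵥ d = fun b : B => riesz y (monomial b.1.1 1 * (X i * ofCoords B d)) := by
  funext b
  rw [← mul_assoc, riesz_mul_ofCoords]
  simp [shiftedBlock, mulVec, dotProduct, monomial_mul, X, add_assoc]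

theorem formalMul_mulVec (i : Fin n) (d : B → ℝ) :
    formalMul y B i *ᵥ d = coords y B (X i * ofCoords B d) := by
  rw [formalMul, ← mulVec_mulVec, shiftedBlock_mulVec, coords_apply]

theorem principal_transpose : (principal y B)ᵀ = principal y B := by
  ext b c
  simp [principal, momentMatrix, add_comm]

theorem shiftedBlock_transpose (i : Fin n) : (shiftedBlock y B i)ᵀ = shiftedBlock y B i := by
  ext b c
  simp [shiftedBlock, add_comm, add_left_comm]

theorem coords_eq_zero {p : MvPolynomial (Fin n) ℝ}
    (hp : ∀ b : B, riesz y (monomial b.1.1 1 * p) = 0) : coords y B p = 0 := by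
  rw [coords_apply, funext hp]
  exact mulVec_zero _

theorem coords_eq_zero_of_mem_momentKer {p : MvPolynomial (Fin n) ℝ}
    (hp : p ∈ momentKer y (k + 1)) : coords y B p = 0 :=
  coords_eq_zero fun b => (mem_momentKer_iff_monomial.1 hp).2 _ (b.1.2.trans k.le_succ)

/-- Since B has degree at most k rather than k + 1, the factor x_i can be moved onto x^b without
leaving the range where p is orthogonal. This lets kernel relations be multiplied by a variable. -/
theorem coords_X_mul_eq_zero {p : MvPolynomial (Fin n) ℝ} (hp : p ∈ momentKer y (k + 1))
    (i : Fin n) : coords y B (X i * p) = 0 := by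
  refine coords_eq_zero fun b => ?_
  rw [← mul_assoc]
  refine riesz_mul_eq_zero hp ((totalDegree_mul _ _).trans ?_)
  rw [totalDegree_monomial_one, totalDegree_X]
  exact Nat.add_le_add_right b.1.2 1

namespace IsFlat

theorem isUnit_det (hB : IsFlat y B) : IsUnit (principal y B).det :=
  isUnit_iff_ne_zero.2 hB.det_ne_zero

theorem coords_ofCoords (hB : IsFlat y B) (d : B → ℝ) : coords y B (ofCoords B d) = d := by
  rw [coords_apply, ← principal_mulVec, mulVec_mulVec, nonsing_inv_mul _ hB.isUnit_det, one_mulVec]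

/-- The columns of `M_{k+1}(y)` indexed by `B` span the column space. -/
theorem exists_sub_mem_momentKer (hB : IsFlat y B) {p : MvPolynomial (Fin n) ℝ}
    (hp : p.totalDegree ≤ k + 1) : ∃ d : B → ℝ, p - ofCoords B d ∈ momentKer y (k + 1) := by
  let E : (B → ℝ) →ₗ[ℝ] (MonoIdx n (k + 1) → ℝ) :=
    (LinearMap.pi fun α : MonoIdx n (k + 1) => lcoeff ℝ α.1) ∘ₗ ofCoords B
  let N := (momentMatrix y (k + 1)).mulVecLin
  have hdeg : ∀ d : B → ℝ, (ofCoords B d).totalDegree ≤ k + 1 := fun d =>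
    (totalDegree_ofCoords_le d).trans k.le_succ
  have hN : ∀ (d : B → ℝ) (α : MonoIdx n (k + 1)),
      (N ∘ₗ E) d α = riesz y (monomial α.1 1 * ofCoords B d) := fun d α =>
    momentMatrix_mulVec_coeff y (hdeg d) α
  have hinj : Function.Injective (N ∘ₗ E) := by
    rw [← LinearMap.ker_eq_bot, LinearMap.ker_eq_bot']
    intro d hd
    rw [← hB.coords_ofCoords d]
    refine coords_eq_zero fun b => ?_
    rw [← hN d ⟨b.1.1, b.1.2.trans k.le_succ⟩, hd]
    rfl
  -- The B-columns span a space of dimension |B|, which is the full rank.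
  have hrange : LinearMap.range (N ∘ₗ E) = LinearMap.range N := by
    refine Submodule.eq_of_le_of_finrank_eq (LinearMap.range_comp_le_range E N) ?_
    rw [LinearMap.finrank_range_of_inj hinj, Module.finrank_fintype_fun_eq_card,
      Fintype.card_coe, hB.card_eq]
    rfl
  obtain ⟨d, hd⟩ : N (fun α => p.coeff α.1) ∈ LinearMap.range (N ∘ₗ E) :=
    hrange ▸ LinearMap.mem_range_self N _
  refine ⟨d, mem_momentKer_iff_monomial.2
    ⟨(totalDegree_sub _ _).trans (max_le hp (hdeg d)), fun α hα => ?_⟩⟩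
  rw [mul_sub, map_sub, ← hN d ⟨α, hα⟩, hd, ← momentMatrix_mulVec_coeff y hp ⟨α, hα⟩]
  exact sub_self _

theorem sub_ofCoords_coords_mem (hB : IsFlat y B) {p : MvPolynomial (Fin n) ℝ}
    (hp : p.totalDegree ≤ k + 1) : p - ofCoords B (coords y B p) ∈ momentKer y (k + 1) := by
  obtain ⟨d, hd⟩ := hB.exists_sub_mem_momentKer hp
  have h := coords_eq_zero_of_mem_momentKer (B := B) hd
  rw [map_sub, hB.coords_ofCoords, sub_eq_zero] at h
  rwa [h]

theorem formalMul_mulVec_coords (hB : IsFlat y B) (i : Fin n) {p : MvPolynomial (Fin n) ℝ}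
    (hp : p.totalDegree ≤ k) : formalMul y B i *ᵥ coords y B p = coords y B (X i * p) := by
  have h := coords_X_mul_eq_zero (B := B) (hB.sub_ofCoords_coords_mem (hp.trans k.le_succ)) i
  rw [mul_sub, map_sub, sub_eq_zero] at h
  rw [formalMul_mulVec, h]

theorem principal_mul_formalMul (hB : IsFlat y B) (i : Fin n) :
    principal y B * formalMul y B i = shiftedBlock y B i := by
  rw [formalMul, mul_nonsing_inv_cancel_left _ _ hB.isUnit_det]

/-- Self-adjointness for the form M_B: the Hankel structure makes P_i = M_B 𝒳_i symmetric. -/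
theorem transpose_formalMul_mul_principal (hB : IsFlat y B) (i : Fin n) :
    (formalMul y B i)ᵀ * principal y B = principal y B * formalMul y B i := by
  have h := congrArg transpose (hB.principal_mul_formalMul i)
  rwa [transpose_mul, principal_transpose, shiftedBlock_transpose,
    ← hB.principal_mul_formalMul i] at h

/-- Either product sends d to M_B⁻¹ applied to the numbers L(x^b x_i x_j p), with p the polynomial
with coordinates d, and this is symmetric in i and j. -/
theorem formalMul_comm (hB : IsFlat y B) (i j : Fin n) :
    formalMul y B i * formalMul y B j = formalMul y B j * formalMul y B i := by
  have key : ∀ (i j : Fin n) (d : B → ℝ), (formalMul y B i * formalMul y B j) *ᵥ d =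
      (principal y B)⁻¹ *ᵥ fun b : B =>
        riesz y (monomial b.1.1 1 * (X i * (X j * ofCoords B d))) := by
    intro i j d
    have hdeg : (X j * ofCoords B d).totalDegree ≤ k + 1 := by
      refine (totalDegree_mul _ _).trans ?_
      rw [totalDegree_X, add_comm]
      exact Nat.add_le_add_right (totalDegree_ofCoords_le d) 1
    have h := coords_X_mul_eq_zero (B := B) (hB.sub_ofCoords_coords_mem hdeg) i
    rw [mul_sub, map_sub, sub_eq_zero] at h
    rw [← mulVec_mulVec, formalMul_mulVec, formalMul_mulVec, ← h, coords_apply]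
  refine ext_of_mulVec_single fun b => ?_
  rw [key, key]
  simp only [mul_left_comm (X i)]

/-! ### The quotient by the ideal of the kernel. -/

/-- Evaluation of polynomials at the commuting matrices `𝒳_i`. -/
theorem exists_algHom (hB : IsFlat y B) :
    ∃ φ : MvPolynomial (Fin n) ℝ →ₐ[ℝ] Matrix B B ℝ, ∀ i, φ (X i) = formalMul y B i := by
  have : IsMulCommutative (Algebra.adjoin ℝ (Set.range (formalMul y B))) :=
    Algebra.isMulCommutative_adjoin ℝ (by
      rintro _ ⟨i, rfl⟩ _ ⟨j, rfl⟩
      exact hB.formalMul_comm i j)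
  open scoped IsMulCommutative in
  exact ⟨(Algebra.adjoin ℝ (Set.range (formalMul y B))).val.comp
    (aeval fun i => ⟨formalMul y B i, Algebra.subset_adjoin ⟨i, rfl⟩⟩), fun i => by simp⟩

end IsFlat

/-- Induction on exponents, adding one unit vector at a time. -/
theorem exponent_induction {P : (Fin n →₀ ℕ) → Prop} (zero : P 0)
    (add : ∀ i α, P α → P (Finsupp.single i 1 + α)) (α : Fin n →₀ ℕ) : P α := by
  induction α using Finsupp.induction with
  | zero => exact zero
  | single_add i m α _ _ ih =>
    clear * - ih add
    induction m with
    | zero => simpa using ih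
    | succ m ihm =>
      have h := add i _ ihm
      rwa [← add_assoc, ← Finsupp.single_add, add_comm 1 m] at h

namespace IsFlat

/-- The coordinates of 1 form a cyclic vector. Induction on monomials reaches degree k + 1 because
the factor left after removing one variable has degree at most k, as `formalMul_mulVec_coords`
requires. -/
theorem algHom_mulVec_coords_one (hB : IsFlat y B) {φ : MvPolynomial (Fin n) ℝ →ₐ[ℝ] Matrix B B ℝ}
    (hφ : ∀ i, φ (X i) = formalMul y B i) {p : MvPolynomial (Fin n) ℝ}
    (hp : p.totalDegree ≤ k + 1) : φ p *ᵥ coords y B 1 = coords y B p := by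
  have key := map_eq_zero_of_totalDegree_le
    ((LinearMap.applyₗ (coords y B 1)) ∘ₗ mulVecBilin ℝ ℝ ∘ₗ φ.toLinearMap - coords y B)
    (k := k + 1) ?_ hp
  · exact sub_eq_zero.1 key
  intro α
  rw [LinearMap.sub_apply, sub_eq_zero]
  change _ → φ (monomial α 1) *ᵥ coords y B 1 = coords y B (monomial α 1)
  induction α using exponent_induction with
  | zero =>
    intro _
    rw [show monomial (0 : Fin n →₀ ℕ) (1 : ℝ) = 1 from rfl, map_one, one_mulVec]
  | add i α ih =>
    intro hα
    have hα' : α.degree ≤ k := by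
      rw [map_add, Finsupp.degree_single] at hα
      omega
    have hX : monomial (Finsupp.single i 1 + α) (1 : ℝ) = X i * monomial α 1 := by
      rw [X, monomial_mul, one_mul]
    rw [hX, map_mul, hφ, ← mulVec_mulVec, ih (hα'.trans k.le_succ),
      hB.formalMul_mulVec_coords i ((totalDegree_monomial_one α).trans_le hα')]

theorem algHom_mulVec_eq_zero (hB : IsFlat y B) {φ : MvPolynomial (Fin n) ℝ →ₐ[ℝ] Matrix B B ℝ}
    (hφ : ∀ i, φ (X i) = formalMul y B i) {p : MvPolynomial (Fin n) ℝ}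
    (hp : p ∈ Ideal.span (momentKer y (k + 1))) : φ p *ᵥ coords y B 1 = 0 := by
  induction hp using Submodule.span_induction with
  | mem p hp => rw [hB.algHom_mulVec_coords_one hφ hp.1, coords_eq_zero_of_mem_momentKer hp]
  | zero => rw [map_zero, zero_mulVec]
  | add p q _ _ hp hq => rw [map_add, add_mulVec, hp, hq, add_zero]
  | smul a p _ hp => rw [smul_eq_mul, map_mul, ← mulVec_mulVec, hp, mulVec_zero]

theorem algHom_ofCoords_mulVec (hB : IsFlat y B) {φ : MvPolynomial (Fin n) ℝ →ₐ[ℝ] Matrix B B ℝ}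
    (hφ : ∀ i, φ (X i) = formalMul y B i) (d : B → ℝ) :
    φ (ofCoords B d) *ᵥ coords y B 1 = d := by
  rw [hB.algHom_mulVec_coords_one hφ ((totalDegree_ofCoords_le d).trans k.le_succ),
    hB.coords_ofCoords]

/-- The monomials in `B` span `ℝ[x]` modulo the ideal generated by the kernel. -/
theorem exists_sub_mem_span (hB : IsFlat y B) (p : MvPolynomial (Fin n) ℝ) :
    ∃ d : B → ℝ, p - ofCoords B d ∈ Ideal.span (momentKer y (k + 1)) := by
  induction p using MvPolynomial.induction_on with
  | C a =>
    exact ⟨_, Ideal.subset_span (hB.sub_ofCoords_coords_mem ((totalDegree_C a).trans_le zero_le))⟩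
  | add p q hp hq =>
    obtain ⟨d, hd⟩ := hp
    obtain ⟨e, he⟩ := hq
    refine ⟨d + e, ?_⟩
    rw [map_add, add_sub_add_comm]
    exact Ideal.add_mem _ hd he
  | mul_X p i hp =>
    obtain ⟨d, hd⟩ := hp
    have hdeg : (ofCoords B d * X i).totalDegree ≤ k + 1 := by
      refine (totalDegree_mul _ _).trans ?_
      rw [totalDegree_X]
      exact Nat.add_le_add_right (totalDegree_ofCoords_le d) 1
    refine ⟨coords y B (ofCoords B d * X i), ?_⟩
    -- Reducing p first keeps the product with x_i in degree at most k + 1, where a kernel relation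
    -- reduces it again.
    rw [← sub_add_sub_cancel _ (ofCoords B d * X i), ← sub_mul]
    exact Ideal.add_mem _ (Ideal.mul_mem_right _ _ hd)
      (Ideal.subset_span (hB.sub_ofCoords_coords_mem hdeg))

theorem mem_span_iff (hB : IsFlat y B) {φ : MvPolynomial (Fin n) ℝ →ₐ[ℝ] Matrix B B ℝ}
    (hφ : ∀ i, φ (X i) = formalMul y B i) {p : MvPolynomial (Fin n) ℝ} :
    p ∈ Ideal.span (momentKer y (k + 1)) ↔ φ p *ᵥ coords y B 1 = 0 := by
  refine ⟨hB.algHom_mulVec_eq_zero hφ, fun h => ?_⟩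
  obtain ⟨d, hd⟩ := hB.exists_sub_mem_span p
  have h' := hB.algHom_mulVec_eq_zero hφ hd
  rw [map_sub, sub_mulVec, h, hB.algHom_ofCoords_mulVec hφ, zero_sub, neg_eq_zero] at h'
  rwa [h', map_zero, sub_zero] at hd

theorem ofCoords_mem_span_iff (hB : IsFlat y B) {d : B → ℝ} :
    ofCoords B d ∈ Ideal.span (momentKer y (k + 1)) ↔ d = 0 := by
  obtain ⟨φ, hφ⟩ := hB.exists_algHom
  rw [hB.mem_span_iff hφ, hB.algHom_ofCoords_mulVec hφ]

theorem transpose_algHom_mul_principal (hB : IsFlat y B)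
    {φ : MvPolynomial (Fin n) ℝ →ₐ[ℝ] Matrix B B ℝ}
    (hφ : ∀ i, φ (X i) = formalMul y B i) (p : MvPolynomial (Fin n) ℝ) :
    (φ p)ᵀ * principal y B = principal y B * φ p := by
  induction p using MvPolynomial.induction_on with
  | C a =>
    rw [← algebraMap_eq, AlgHom.commutes, Algebra.algebraMap_eq_smul_one, transpose_smul,
      transpose_one, smul_mul_assoc, mul_smul_comm, one_mul, mul_one]
  | add p q hp hq => rw [map_add, transpose_add, add_mul, mul_add, hp, hq]
  | mul_X p i hp =>
    rw [map_mul, transpose_mul, mul_assoc, hp, ← mul_assoc, hφ,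
      hB.transpose_formalMul_mul_principal, mul_assoc, ← hφ, ← map_mul, ← map_mul, mul_comm]

/-- With c the coordinates of 1, self-adjointness turns cᵀM_Bφ(p²)c into the squared M_B-norm of
φ(p)c. Two such norms sum to zero, and M_B is positive semidefinite and invertible. -/
theorem mem_span_of_sq_add_sq_mem (hB : IsFlat y B) {p q : MvPolynomial (Fin n) ℝ}
    (h : p * p + q * q ∈ Ideal.span (momentKer y (k + 1))) :
    p ∈ Ideal.span (momentKer y (k + 1)) := by
  obtain ⟨φ, hφ⟩ := hB.exists_algHom
  rw [hB.mem_span_iff hφ] at h ⊢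
  have hpsd : (principal y B).PosSemidef :=
    (momentMatrix_posSemidef_mono k.le_succ hB.posSemidef).submatrix _
  have hsq : ∀ p, (φ p *ᵥ coords y B 1) ⬝ᵥ principal y B *ᵥ (φ p *ᵥ coords y B 1) =
      coords y B 1 ⬝ᵥ principal y B *ᵥ (φ (p * p) *ᵥ coords y B 1) := by
    intro p
    symm
    rw [map_mul, mulVec_mulVec, ← mul_assoc, ← hB.transpose_algHom_mul_principal hφ, mul_assoc,
      ← mulVec_mulVec, ← mulVec_mulVec, dotProduct_mulVec _ (φ p)ᵀ, vecMul_transpose]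
  have hnn : ∀ p, 0 ≤ coords y B 1 ⬝ᵥ principal y B *ᵥ (φ (p * p) *ᵥ coords y B 1) := fun p => by
    rw [← hsq]
    simpa using hpsd.dotProduct_mulVec_nonneg (φ p *ᵥ coords y B 1)
  have hzero : coords y B 1 ⬝ᵥ principal y B *ᵥ (φ (p * p) *ᵥ coords y B 1) = 0 := by
    refine le_antisymm ?_ (hnn p)
    have h0 : coords y B 1 ⬝ᵥ principal y B *ᵥ (φ (p * p + q * q) *ᵥ coords y B 1) = 0 := by
      rw [h, mulVec_zero, dotProduct_zero]
    rw [map_add, add_mulVec, mulVec_add, dotProduct_add] at h0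
    linarith [hnn q]
  rw [← hsq] at hzero
  have h1 := (hpsd.dotProduct_mulVec_zero_iff (φ p *ᵥ coords y B 1)).1
    (by rwa [star_trivial])
  have h2 := congrArg ((principal y B)⁻¹ *ᵥ ·) h1
  simpa only [mulVec_mulVec, ← mul_assoc, nonsing_inv_mul _ hB.isUnit_det, one_mul, mulVec_zero]
    using h2

/-! ### Radicality, real zeros and their number. -/

theorem span_isRadical (hB : IsFlat y B) : (Ideal.span (momentKer y (k + 1))).IsRadical := by
  rw [Ideal.isRadical_iff_pow_one_lt 2 one_lt_two]
  intro p hp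
  refine hB.mem_span_of_sq_add_sq_mem (q := 0) ?_
  rwa [mul_zero, add_zero, ← sq]

theorem vanishingIdeal_complexVariety (hB : IsFlat y B) :
    vanishingIdeal ℝ (complexVariety (Ideal.span (momentKer y (k + 1)))) =
      Ideal.span (momentKer y (k + 1)) := by
  rw [complexVariety, vanishingIdeal_zeroLocus_eq_radical, hB.span_isRadical.radical]

/-- A polynomial that is a nonzerodivisor modulo the ideal is a unit modulo the ideal. -/
theorem exists_mul_sub_one_mem (hB : IsFlat y B) {q : MvPolynomial (Fin n) ℝ}
    (hq : ∀ p, q * p ∈ Ideal.span (momentKer y (k + 1)) → p ∈ Ideal.span (momentKer y (k + 1))) :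
    ∃ p, q * p - 1 ∈ Ideal.span (momentKer y (k + 1)) := by
  obtain ⟨φ, hφ⟩ := hB.exists_algHom
  have hinj : Function.Injective (φ q).mulVecLin := by
    rw [← LinearMap.ker_eq_bot, LinearMap.ker_eq_bot']
    intro d hd
    rw [← hB.ofCoords_mem_span_iff]
    apply hq
    rw [hB.mem_span_iff hφ, map_mul, ← mulVec_mulVec, hB.algHom_ofCoords_mulVec hφ]
    exact hd
  obtain ⟨d, hd⟩ := LinearMap.injective_iff_surjective.1 hinj (coords y B 1)
  refine ⟨ofCoords B d, ?_⟩
  rw [hB.mem_span_iff hφ, map_sub, sub_mulVec, map_one φ, one_mulVec, map_mul, ← mulVec_mulVec,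
    hB.algHom_ofCoords_mulVec hφ, sub_eq_zero]
  exact hd

/-- All complex zeros of the ideal are real. -/
theorem im_eq_zero (hB : IsFlat y B) {v : Fin n → ℂ}
    (hv : v ∈ complexVariety (Ideal.span (momentKer y (k + 1)))) (i : Fin n) : (v i).im = 0 := by
  by_contra hne
  set J := Ideal.span (momentKer y (k + 1)) with hJ
  set l : MvPolynomial (Fin n) ℝ := X i - C (v i).re with hl
  -- For v_i = a + bi with b ≠ 0, q = b² + (x_i - a)² is a nonzerodivisor modulo J: qp ∈ J gives
  -- (bp)² + (lp)² ∈ J. So q is a unit modulo J, yet it vanishes at v.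
  obtain ⟨p, hp⟩ := hB.exists_mul_sub_one_mem (q := C (v i).im * C (v i).im + l * l) (by
    intro p hp
    have h1 : C (v i).im * p ∈ J := hB.mem_span_of_sq_add_sq_mem (q := l * p) (by
      convert Ideal.mul_mem_left J p hp using 1
      ring)
    convert Ideal.mul_mem_left J (C (v i).im⁻¹) h1 using 1
    rw [← mul_assoc, ← C_mul, inv_mul_cancel₀ hne, C_1, one_mul])
  have h := hv _ hp
  have hq : ((v i).im : ℂ) * (v i).im + (v i - (v i).re) * (v i - (v i).re) = 0 := by
    have : v i - (v i).re = (v i).im * Complex.I := by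
      nth_rewrite 1 [← Complex.re_add_im (v i)]
      ring
    rw [this]
    linear_combination ((v i).im : ℂ) * (v i).im * Complex.I_mul_I
  simp [hl, hq] at h

theorem aeval_im_eq_zero {v : Fin n → ℂ} (hv : ∀ i, (v i).im = 0) (p : MvPolynomial (Fin n) ℝ) :
    (aeval v p).im = 0 := by
  have hv' : v = algebraMap ℝ ℂ ∘ fun i => (v i).re := funext fun i => Complex.ext rfl (hv i)
  rw [hv', aeval_algebraMap_apply]
  exact Complex.ofReal_im _

/-- Zeros give distinct algebra maps from ℝ[x]/J to ℂ, at most dim ℝ[x]/J = |B| of them. Conversely,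
evaluation on the zeros is injective on the span of B, because J is the whole vanishing ideal. -/
theorem encard_complexVariety (hB : IsFlat y B) :
    (complexVariety (Ideal.span (momentKer y (k + 1)))).encard = B.card := by
  set J := Ideal.span (momentKer y (k + 1)) with hJ
  let e : (B → ℝ) →ₗ[ℝ] MvPolynomial (Fin n) ℝ ⧸ J :=
    (Ideal.Quotient.mkₐ ℝ J).toLinearMap ∘ₗ ofCoords B
  have he : Function.Bijective e := by
    constructor
    · rw [← LinearMap.ker_eq_bot, LinearMap.ker_eq_bot']
      intro d hd
      exact hB.ofCoords_mem_span_iff.1 (Ideal.Quotient.eq_zero_iff_mem.1 hd)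
    · intro a
      obtain ⟨p, rfl⟩ := Ideal.Quotient.mk_surjective a
      obtain ⟨d, hd⟩ := hB.exists_sub_mem_span p
      exact ⟨d, (Ideal.Quotient.eq.2 hd).symm⟩
  let E := LinearEquiv.ofBijective e he
  have : Module.Finite ℝ (MvPolynomial (Fin n) ℝ ⧸ J) := Module.Finite.equiv E
  have hfr : Module.finrank ℝ (MvPolynomial (Fin n) ℝ ⧸ J) = B.card := by
    rw [← E.finrank_eq, Module.finrank_fintype_fun_eq_card, Fintype.card_coe]
  let g : complexVariety J → (MvPolynomial (Fin n) ℝ ⧸ J →ₐ[ℝ] ℂ) := fun v =>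
    Ideal.Quotient.liftₐ J (aeval v.1) v.2
  have hg : Function.Injective g := fun v w hvw => Subtype.ext <| funext fun i => by
    have h : aeval v.1 (X i : MvPolynomial (Fin n) ℝ) = aeval w.1 (X i) :=
      DFunLike.congr_fun hvw (Ideal.Quotient.mk J (X i))
    rwa [aeval_X, aeval_X] at h
  have : Finite (complexVariety J) := Finite.of_injective g hg
  have : Fintype (complexVariety J) := Fintype.ofFinite _
  have hle : Nat.card (complexVariety J) ≤ B.card :=
    (Nat.card_le_card_of_injective g hg).trans ((card_algHom_le_finrank ℝ _ ℂ).trans hfr.le)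
  -- Real parts lose nothing, as the zeros are real.
  let G : (B → ℝ) →ₗ[ℝ] (complexVariety J → ℝ) :=
    (LinearMap.pi fun v : complexVariety J => Complex.reLm ∘ₗ (aeval v.1).toLinearMap) ∘ₗ ofCoords B
  have hG : Function.Injective G := by
    rw [← LinearMap.ker_eq_bot, LinearMap.ker_eq_bot']
    intro d hd
    rw [← hB.ofCoords_mem_span_iff, ← hB.vanishingIdeal_complexVariety]
    exact fun v hv => Complex.ext (congrFun hd ⟨v, hv⟩) (aeval_im_eq_zero (hB.im_eq_zero hv) _)
  have hge := LinearMap.finrank_le_finrank_of_injective hG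
  rw [Module.finrank_fintype_fun_eq_card, Module.finrank_fintype_fun_eq_card, Fintype.card_coe,
    ← Nat.card_eq_fintype_card] at hge
  rw [← (Set.toFinite (complexVariety J)).cast_ncard_eq, ← Nat.card_coe_set_eq, le_antisymm hle hge]

/-! ### Joint eigenvalues. -/

theorem aeval_ofCoords (v : Fin n → ℂ) (d : B → ℝ) :
    aeval v (ofCoords B d) = ∑ b : B, (d b : ℂ) * aeval v (monomial b.1.1 (1 : ℝ)) := by
  simp [ofCoords, Fintype.linearCombination_apply]

/-- The eigenvector is (v^b)_{b ∈ B}; it is nonzero because 1 is a combination of B modulo J. -/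
theorem mem_jointEigenvalues (hB : IsFlat y B) {v : Fin n → ℂ}
    (hv : v ∈ complexVariety (Ideal.span (momentKer y (k + 1)))) :
    v ∈ jointEigenvalues (formalMul y B) := by
  refine ⟨fun b => aeval v (monomial b.1.1 (1 : ℝ)), fun hu => ?_, fun i => funext fun c => ?_⟩
  · obtain ⟨d, hd⟩ := hB.exists_sub_mem_span 1
    have h := hv _ hd
    rw [map_sub, aeval_ofCoords, map_one, Finset.sum_eq_zero, sub_zero] at h
    · exact one_ne_zero h
    · exact fun b _ => by rw [congrFun hu b, Pi.zero_apply, mul_zero]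
  · have hdeg : (X i * monomial c.1.1 (1 : ℝ)).totalDegree ≤ k + 1 := by
      refine (totalDegree_mul _ _).trans ?_
      rw [totalDegree_X, totalDegree_monomial_one, add_comm]
      exact Nat.add_le_add_right c.1.2 1
    have h := hv _ (Ideal.subset_span (hB.sub_ofCoords_coords_mem hdeg))
    rw [map_sub, sub_eq_zero, ← ofCoords_single, ← formalMul_mulVec, mulVec_single_one,
      aeval_ofCoords, ofCoords_single, map_mul, aeval_X] at h
    exact h.symm

/-- Pairing φ(p)c with u, where c is the coordinate vector of 1, gives a functional l with l(x_i p)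
= v_i l(p), so l is l(1) times evaluation at v. It kills J, and l(1) ≠ 0 since l(x^b) = u_b. -/
theorem mem_complexVariety (hB : IsFlat y B) {v : Fin n → ℂ}
    (hv : v ∈ jointEigenvalues (formalMul y B)) :
    v ∈ complexVariety (Ideal.span (momentKer y (k + 1))) := by
  obtain ⟨u, hu, hX⟩ := hv
  obtain ⟨φ, hφ⟩ := hB.exists_algHom
  let l : MvPolynomial (Fin n) ℝ → ℂ := fun p => ∑ b, ((φ p *ᵥ coords y B 1) b : ℂ) * u b
  have hl : ∀ p, l p = aeval v p * l 1 := by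
    intro p
    induction p using MvPolynomial.induction_on with
    | C a =>
      simp only [l, ← algebraMap_eq, AlgHom.commutes, map_one, one_mulVec, Finset.mul_sum]
      simp [Algebra.algebraMap_eq_smul_one, smul_mulVec, mul_assoc]
    | add p q hp hq =>
      rw [map_add, add_mul, ← hp, ← hq]
      simp [l, add_mulVec, add_mul, Finset.sum_add_distrib]
    | mul_X p i hp =>
      rw [mul_comm, map_mul, aeval_X, mul_assoc, ← hp]
      simp only [l]
      rw [map_mul, ← mulVec_mulVec, hφ]
      generalize φ p *ᵥ coords y B 1 = w
      have hi : ∀ c, ∑ b, (formalMul y B i b c : ℂ) * u b = v i * u c := fun c =>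
        congrFun (hX i) c
      simp only [mulVec, dotProduct, Complex.ofReal_sum, Complex.ofReal_mul, Finset.sum_mul]
      rw [Finset.sum_comm, Finset.mul_sum]
      refine Finset.sum_congr rfl fun c _ => ?_
      rw [mul_left_comm, ← hi c, Finset.mul_sum]
      exact Finset.sum_congr rfl fun b _ => by ring
  have hl1 : l 1 ≠ 0 := by
    intro h1
    apply hu
    funext b
    have hb := hl (ofCoords B (Pi.single b 1))
    rw [h1, mul_zero] at hb
    simp only [l, hB.algHom_ofCoords_mulVec hφ] at hb
    rw [Finset.sum_eq_single b] at hb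
    · simpa using hb
    · intro c _ hc
      simp [hc]
    · simp
  intro p hp
  have h := hl p
  have h0 : l p = 0 := by simp [l, hB.algHom_mulVec_eq_zero hφ hp]
  exact (mul_eq_zero.1 (h.symm.trans h0)).resolve_right hl1

end IsFlat

/-! ### Point masses and the maximality of the rank. -/

/-- The truncated moment sequence `(x^α)` of the point mass at `x`. -/
def pointMoments (x : Fin n → ℝ) (k : ℕ) (α : MonoIdx n k) : ℝ :=
  eval x (monomial α.1 1)

theorem extend_pointMoments {x : Fin n → ℝ} {k : ℕ} {α : Fin n →₀ ℕ} (hα : α.degree ≤ k) :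
    extend (pointMoments x k) α = eval x (monomial α 1) := by
  rw [extend, dif_pos hα, pointMoments]

theorem momentMatrix_pointMoments (x : Fin n → ℝ) (t : ℕ) :
    momentMatrix (extend (pointMoments x (2 * t))) t =
      vecMulVec (fun α : MonoIdx n t => eval x (monomial α.1 1))
        (fun α => eval x (monomial α.1 1)) := by
  ext α β
  have h : (α.1 + β.1).degree ≤ 2 * t := by
    rw [map_add, two_mul]
    exact add_le_add α.2 β.2
  rw [momentMatrix, of_apply, extend_pointMoments h, vecMulVec_apply, ← map_mul, monomial_mul,
    one_mul]

theorem halfDeg_le_maxHalfDeg {m : ℕ} (h : Fin m → MvPolynomial (Fin n) ℝ) (j : Fin m) :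
    halfDeg (h j) ≤ maxHalfDeg h :=
  Finset.le_sup (f := fun j => halfDeg (h j)) (Finset.mem_univ j)

theorem totalDegree_le_two_mul_halfDeg (p : MvPolynomial (Fin n) ℝ) :
    p.totalDegree ≤ 2 * halfDeg p := by
  have h := Nat.le_ceil ((p.totalDegree : ℚ) / 2)
  rw [div_le_iff₀ two_pos] at h
  rw [mul_comm]
  exact_mod_cast h

theorem pointMoments_mem_feasible {m t : ℕ} {h : Fin m → MvPolynomial (Fin n) ℝ}
    (ht : maxHalfDeg h ≤ t) {x : Fin n → ℝ} (hx : ∀ j, eval x (h j) = 0) :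
    pointMoments x (2 * t) ∈ feasible h t := by
  refine ⟨?_, ?_, fun j => ?_⟩
  · rw [extend_pointMoments (by simp)]
    simp
  · rw [momentMatrix_pointMoments]
    simpa using posSemidef_vecMulVec_self_star (fun α : MonoIdx n t => eval x (monomial α.1 1))
  · ext α β
    have hj := (halfDeg_le_maxHalfDeg h j).trans ht
    have hdeg := totalDegree_le_two_mul_halfDeg (h j)
    have hterm : ∀ γ ∈ (h j).support, (h j).coeff γ * extend (pointMoments x (2 * t))
        (α.1 + β.1 + γ) = eval x (monomial (α.1 + β.1) 1) * eval x (monomial γ ((h j).coeff γ)) := by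
      intro γ hγ
      have hγ' : γ.degree ≤ (h j).totalDegree := le_totalDegree hγ
      have hα := α.2
      have hβ := β.2
      -- The exponent has degree at most 2(t - d_j) + 2d_j = 2t, so the zero default of `extend`
      -- never enters; d_j ≤ t keeps the subtraction from truncating.
      rw [extend_pointMoments (by rw [map_add, map_add]; omega), ← map_mul, monomial_mul, one_mul,
        ← smul_eval, smul_monomial, smul_eq_mul, mul_one]
    rw [momentMatrix, of_apply, shift, Finset.sum_congr rfl hterm, ← Finset.mul_sum, ← map_sum,
      ← as_sum, hx j, mul_zero, Matrix.zero_apply]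

theorem extend_midpoint {k : ℕ} (y z : MonoIdx n k → ℝ) :
    extend ((1 / 2 : ℝ) • (y + z)) = (1 / 2 : ℝ) • (extend y + extend z) := by
  funext α
  by_cases hα : α.degree ≤ k <;> simp [extend, hα]

theorem momentMatrix_midpoint (y z : (Fin n →₀ ℕ) → ℝ) (s : ℕ) :
    momentMatrix ((1 / 2 : ℝ) • (y + z)) s =
      (1 / 2 : ℝ) • (momentMatrix y s + momentMatrix z s) :=
  rfl

theorem shift_midpoint (h : MvPolynomial (Fin n) ℝ) (y z : (Fin n →₀ ℕ) → ℝ) :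
    shift h ((1 / 2 : ℝ) • (y + z)) = (1 / 2 : ℝ) • (shift h y + shift h z) := by
  funext α
  simp only [shift, Pi.smul_apply, Pi.add_apply, smul_eq_mul, ← Finset.sum_add_distrib,
    Finset.mul_sum]
  exact Finset.sum_congr rfl fun β _ => by ring

theorem midpoint_mem_feasible {m t : ℕ} {h : Fin m → MvPolynomial (Fin n) ℝ}
    {y z : MonoIdx n (2 * t) → ℝ} (hy : y ∈ feasible h t) (hz : z ∈ feasible h t) :
    (1 / 2 : ℝ) • (y + z) ∈ feasible h t := by
  refine ⟨?_, ?_, fun j => ?_⟩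
  · rw [extend_midpoint, Pi.smul_apply, Pi.add_apply, hy.1, hz.1]
    norm_num
  · rw [extend_midpoint, momentMatrix_midpoint]
    exact (hy.2.1.add hz.2.1).smul (by norm_num)
  · rw [extend_midpoint, shift_midpoint, momentMatrix_midpoint, hy.2.2 j, hz.2.2 j, add_zero,
      smul_zero]

/-- If the rank of `M` is at least that of `(M + N) / 2`, then the kernel of `M` is contained in
that of `N`. -/
theorem mulVec_eq_zero_of_rank_midpoint_le {ι : Type*} [Fintype ι] {M N : Matrix ι ι ℝ}
    (hM : M.PosSemidef) (hN : N.PosSemidef)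
    (hrank : ((1 / 2 : ℝ) • (M + N)).rank ≤ M.rank) {u : ι → ℝ} (hu : M *ᵥ u = 0) :
    N *ᵥ u = 0 := by
  have hker : ∀ w, ((1 / 2 : ℝ) • (M + N)) *ᵥ w = 0 → M *ᵥ w = 0 := by
    intro w hw
    rw [smul_mulVec, smul_eq_zero_iff_right (by norm_num), add_mulVec] at hw
    have h := congrArg (star w ⬝ᵥ ·) hw
    simp only [dotProduct_add, dotProduct_zero] at h
    rw [← hM.dotProduct_mulVec_zero_iff]
    linarith [hM.dotProduct_mulVec_nonneg w, hN.dotProduct_mulVec_nonneg w]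
  have hle : LinearMap.ker ((1 / 2 : ℝ) • (M + N)).mulVecLin ≤ LinearMap.ker M.mulVecLin :=
    fun w hw => hker w hw
  have heq := Submodule.eq_of_le_of_finrank_le hle (by
    have h1 := M.mulVecLin.finrank_range_add_finrank_ker
    have h2 := ((1 / 2 : ℝ) • (M + N)).mulVecLin.finrank_range_add_finrank_ker
    change M.rank + _ = _ at h1
    change ((1 / 2 : ℝ) • (M + N)).rank + _ = _ at h2
    omega)
  have hmem : u ∈ LinearMap.ker ((1 / 2 : ℝ) • (M + N)).mulVecLin := by
    rw [heq]
    exact hu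
  have h := show ((1 / 2 : ℝ) • (M + N)) *ᵥ u = 0 from hmem
  rwa [smul_mulVec, smul_eq_zero_iff_right (by norm_num), add_mulVec, hu, zero_add] at h

/-- At a feasible sequence of maximum rank, the polynomials in the kernel of the moment matrix
vanish on the real variety. -/
theorem momentKer_subset_vanishingIdeal {m t : ℕ} {h : Fin m → MvPolynomial (Fin n) ℝ}
    (ht : maxHalfDeg h ≤ t) {y : MonoIdx n (2 * t) → ℝ} (hy : y ∈ feasible h t)
    (hmax : ∀ z ∈ feasible h t,
      (momentMatrix (extend z) t).rank ≤ (momentMatrix (extend y) t).rank) :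
    momentKer (extend y) t ⊆ vanishingIdeal ℝ (realVariety (Ideal.span (Set.range h))) := by
  rintro p hp _ ⟨hv, x, rfl⟩
  have haeval : ∀ q : MvPolynomial (Fin n) ℝ,
      aeval (fun i => (x i : ℂ)) q = ((eval x q : ℝ) : ℂ) := fun q =>
    aeval_algebraMap_apply ℂ x q
  have hx : ∀ j, eval x (h j) = 0 := fun j => by
    have hj := hv _ (Ideal.subset_span ⟨j, rfl⟩)
    rw [haeval] at hj
    exact_mod_cast hj
  have hz := pointMoments_mem_feasible ht hx
  have hrank := hmax _ (midpoint_mem_feasible hy hz)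
  rw [extend_midpoint, momentMatrix_midpoint] at hrank
  have hker := mulVec_eq_zero_of_rank_midpoint_le hy.2.1 hz.2.1 hrank hp.2
  -- The row indexed by the exponent 0 of the point-mass matrix lists the monomials at x, so it
  -- pairs with p to p(x).
  have h0 := congrFun hker ⟨0, by simp⟩
  rw [momentMatrix_pointMoments] at h0
  simp only [mulVec, dotProduct, vecMulVec_apply, Pi.zero_apply] at h0
  have hp0 : eval x p = 0 := by
    rw [← sum_coeff_monomial hp.1, map_sum, ← h0]
    refine Finset.sum_congr rfl fun β _ => ?_
    simp [eval_monomial, mul_comm]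
  rw [haeval, hp0, Complex.ofReal_zero]

end

end RealMoment

/-! ### Assembly. -/

theorem mainTheorem4 (n m : ℕ) (h : Fin m → MvPolynomial (Fin n) ℝ)
    (I : Ideal (MvPolynomial (Fin n) ℝ)) (hI : I = Ideal.span (Set.range h))
    (t : ℕ) (ht : RealMoment.maxHalfDeg h ≤ t)
    (y : RealMoment.MonoIdx n (2 * t) → ℝ) (hy : y ∈ RealMoment.feasible h t)
    (hmax : ∀ z ∈ RealMoment.feasible h t,
      (RealMoment.momentMatrix (RealMoment.extend z) t).rank ≤
        (RealMoment.momentMatrix (RealMoment.extend y) t).rank)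
    (s : ℕ) (hs : 1 ≤ s) (hst : s ≤ t) (r : ℕ)
    (hr : (RealMoment.momentMatrix (RealMoment.extend y) s).rank = r)
    (hr' : (RealMoment.momentMatrix (RealMoment.extend y) (s - 1)).rank = r)
    (J : Ideal (MvPolynomial (Fin n) ℝ))
    (hJ : J = Ideal.span (RealMoment.momentKer (RealMoment.extend y) s))
    (W : Set (Fin n → ℂ)) (hW : W = RealMoment.complexVariety J) :
    J ≤ MvPolynomial.vanishingIdeal ℝ (RealMoment.realVariety I) ∧
    ((∃ B : Finset (RealMoment.MonoIdx n (s - 1)),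
        RealMoment.IsMaxNonsingular (RealMoment.extend y) B) ∧
      ∀ B : Finset (RealMoment.MonoIdx n (s - 1)),
        RealMoment.IsMaxNonsingular (RealMoment.extend y) B →
          W = RealMoment.jointEigenvalues (RealMoment.formalMul (RealMoment.extend y) B)) ∧
    RealMoment.realVariety I ⊆ W ∧
    W.encard = (r : ℕ∞) ∧
    (W = RealMoment.realVariety I →
      MvPolynomial.vanishingIdeal ℝ (RealMoment.realVariety I) = J) := by
  subst hI hJ hW
  obtain ⟨k, rfl⟩ : ∃ k, s = k + 1 := ⟨s - 1, by omega⟩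
  rw [Nat.add_sub_cancel] at hr' ⊢
  have hpsd := RealMoment.momentMatrix_posSemidef_mono hst hy.2.1
  have hpsd' := RealMoment.momentMatrix_posSemidef_mono k.le_succ hpsd
  have hflat : ∀ B : Finset (RealMoment.MonoIdx n k),
      RealMoment.IsMaxNonsingular (RealMoment.extend y) B →
        RealMoment.IsFlat (RealMoment.extend y) B := fun B hB =>
    -- The rank hypothesis enters here: |B| = rank M_k(y) = rank M_{k+1}(y).
    ⟨hpsd, hB.1, (hB.card_eq_rank hpsd').trans (hr'.trans hr.symm)⟩
  obtain ⟨B₀, hB₀⟩ := RealMoment.exists_isMaxNonsingular hpsd'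
  have hJ : Ideal.span (RealMoment.momentKer (RealMoment.extend y) (k + 1)) ≤
      MvPolynomial.vanishingIdeal ℝ (RealMoment.realVariety (Ideal.span (Set.range h))) :=
    Ideal.span_le.2 ((RealMoment.momentKer_mono hst hy.2.1).trans
      (RealMoment.momentKer_subset_vanishingIdeal ht hy hmax))
  refine ⟨hJ, ⟨⟨B₀, hB₀⟩, fun B hB => Set.Subset.antisymm
    (fun v hv => (hflat B hB).mem_jointEigenvalues hv)
    (fun v hv => (hflat B hB).mem_complexVariety hv)⟩, fun v hv p hp => hJ hp v hv, ?_, fun hW => ?_⟩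
  · rw [(hflat B₀ hB₀).encard_complexVariety, (hflat B₀ hB₀).card_eq, hr]
  · rw [← hW, (hflat B₀ hB₀).vanishingIdeal_complexVariety]
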